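/- Let $\delta\ge 1$ and let $\Pi=(\delta,\Sigma,\mathcal C)$ be an LCL problem: $\Sigma$ is a finite set of labels and $\mathcal C\subseteq\Sigma^{\delta+1}$ is a set of allowed configurations, written $(a:b_1,\dots,b_\delta)$. Inputs are finite rooted full $\delta$-ary trees (every node has either $0$ or exactly $\delta$ children). A solution is a labeling $\lambda$ of the nodes by $\Sigma$ such that for every node $v$ with children $v_1,\dots,v_\delta$ there is a permutation $\rho$ with $(\lambda(v):\lambda(v_{\rho(1)}),\dots,\lambda(v_{\rho(\delta)}))\in\mathcal C$; leaves are unconstrained. A certificate $\mathcal T$ for $O(\log^* n)$ solvability of $\Pi$ consists of a set $\Sigma_{\mathcal T}\subseteq\Sigma$, a depth $d\ge 1$, and, for each $\sigma\in\Sigma_{\mathcal T}$, a complete $\delta$-ary tree $\mathcal T_\sigma$ of depth $d$ whose nodes are labeled by a solution of $\Pi$ that uses only labels of $\Sigma_{\mathcal T}$ and gives the root the label $\sigma$, such that, after the labels of all non-leaf nodes are removed, all the trees $\mathcal T_\sigma$ are isomorphic as labeled rooted trees. A certificate for $O(1)$ solvability of $\Pi$ is a pair consisting of such a $\mathcal T$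 and a configuration $(a:b_1,\dots,b_\delta)\in\mathcal C$ with $a,b_1,\dots,b_\delta\in\Sigma_{\mathcal T}$ and $b_i=a$ for some $i$, such that at least one leaf of the trees of $\mathcal T$ is labeled $a$. **Theorem.** If $\Pi$ has a certificate for $O(1)$ solvability, then $\Pi$ is solvable in a constant number of rounds by a deterministic algorithm in the CONGEST model. That is, there is a constant $T$ such that for every constant $c$ there are a deterministic synchronous message-passing algorithm and a constant $B$ with the following property. On every full $\delta$-ary tree with $n$ nodes that have distinct identifiers from $\{1,\dots,n^c\}$ and arbitrarily numbered ports to their children, where each node initially knows $n$, the maximum degree, its own identifier, its degree, and which of its edges (if any) leads to its parent, every message has at most $B(\lfloor\log_2 n\rfloor+1)$ bits, and after $T$ rounds all nodes have irrevocably decided on outputs that form a solution of $\Pi$. -/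

import Mathlib

/-! ### Rooted full `δ`-ary trees -/

/-- A rooted full `δ`-ary tree with node set `V`: every node has either no child or exactly `δ`
children. The edges to the children of a node carry the port numbers `0, …, δ - 1` in an arbitrary
order, so that a node can tell its incident edges apart.
`up v = some (u, i)` says that `v` is the child of `u` behind port `i`. -/
structure FullTree (δ : ℕ) (V : Type*) where
  root : V
  up : V → Option (V × Fin δ)
  child : V → Fin δ → Option V
  up_eq_none_iff : ∀ v, up v = none ↔ v = root
  child_eq_some_iff : ∀ v i w, child v i = some w ↔ up w = some (v, i)
  reachable : ∀ v, Relation.ReflTransGen (fun u w => ∃ i, child u i = some w) root v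
  full : ∀ v, (∀ i, child v i = none) ∨ (∀ i, child v i ≠ none)

namespace FullTree

variable {δ : ℕ} {V W : Type*}

/-- The parent of a node (`none` for the root). -/
def parent (G : FullTree δ V) (v : V) : Option V := (G.up v).map Prod.fst

/-- A leaf is a node without children. -/
def IsLeaf (G : FullTree δ V) (v : V) : Prop := ∀ i, G.child v i = none

/-- The number of edges incident to a node. -/
def degree (G : FullTree δ V) (v : V) : ℕ :=
  (Finset.univ.filter fun i => (G.child v i).isSome).card + if (G.up v).isSome then 1 else 0

/-- The maximum degree of the tree. -/
def maxDegree [Fintype V] (G : FullTree δ V) : ℕ := Finset.univ.sup G.degree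

/-- Isomorphisms of rooted trees (the port numbers need not be respected). -/
def IsIso (G : FullTree δ V) (H : FullTree δ W) (φ : V ≃ W) : Prop :=
  ∀ v, H.parent (φ v) = (G.parent v).map φ

end FullTree

/-- The nodes of the complete `δ`-ary tree of depth `d`: words of length at most `d`, where the
empty word is the root and `i :: w` is the `i`-th child of `w`. -/
abbrev CompleteNode (δ d : ℕ) : Type := {w : List (Fin δ) // w.length ≤ d}

/-- The complete `δ`-ary tree of depth `d`. -/
def completeTree (δ d : ℕ) : FullTree δ (CompleteNode δ d) where
  root := ⟨[], Nat.zero_le d⟩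
  up := fun v => match v with
    | ⟨[], _⟩ => none
    | ⟨i :: w, h⟩ => some (⟨w, (Nat.le_succ _).trans h⟩, i)
  child := fun v i => if h : v.1.length < d then some ⟨i :: v.1, h⟩ else none
  up_eq_none_iff := by
    rintro ⟨_ | ⟨i, w⟩, h⟩ <;> simp
  child_eq_some_iff := by
    rintro ⟨v, hv⟩ i ⟨_ | ⟨j, w⟩, h⟩
    · simp
    · have h' : w.length < d := h
      by_cases hvd : v.length < d
      · simp only [hvd, dite_true, Option.some.injEq, Subtype.mk.injEq, List.cons.injEq,
          Prod.mk.injEq]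
        constructor
        · rintro ⟨rfl, rfl⟩; exact ⟨rfl, rfl⟩
        · rintro ⟨rfl, rfl⟩; exact ⟨rfl, rfl⟩
      · simp only [hvd, dite_false, Option.some.injEq, Prod.mk.injEq, Subtype.mk.injEq, false_iff,
          reduceCtorEq]
        rintro ⟨rfl, rfl⟩
        exact hvd h'
  reachable := by
    rintro ⟨w, h⟩
    induction w with
    | nil => exact Relation.ReflTransGen.refl
    | cons i w ih =>
      have h' : w.length < d := h
      exact Relation.ReflTransGen.tail (ih h'.le) ⟨i, by simp [h']⟩
  full := by
    rintro ⟨v, hv⟩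
    by_cases hvd : v.length < d
    · right; intro i; simp [hvd]
    · left; intro i; simp [hvd]

/-! ### LCL problems -/

/-- An LCL problem with `δ` children and label set `L`: a set of allowed configurations
`(a : b₁, …, b_δ)`. -/
structure LCLProblem (δ : ℕ) (L : Type*) where
  configs : Set (L × (Fin δ → L))

/-- A labeling is a solution if, at every node with `δ` children, the labels of the node and of its
children, in some order, form an allowed configuration. -/
def LCLProblem.IsSolution {δ : ℕ} {L V : Type*} (P : LCLProblem δ L) (G : FullTree δ V)
    (lab : V → L) : Prop :=
  ∀ (v : V) (c : Fin δ → V), (∀ i, G.child v i = some (c i)) →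
    ∃ ρ : Equiv.Perm (Fin δ), (lab v, fun i => lab (c (ρ i))) ∈ P.configs

/-! ### Certificates -/

/-- A (uniform) certificate for `O(log* n)` solvability: a set of labels, a depth `d ≥ 1`, and for
each label `σ` of the set a labeled complete `δ`-ary tree of depth `d` that uses only labels of the
set, is correct, and has its root labeled `σ`; once the labels of the non-leaf nodes are removed,
all these trees are isomorphic as labeled rooted trees. -/
structure LogStarCertificate {δ : ℕ} {L : Type*} (P : LCLProblem δ L) where
  labels : Set L
  depth : ℕ
  one_le_depth : 1 ≤ depth
  tree : labels → CompleteNode δ depth → L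
  tree_mem : ∀ σ v, tree σ v ∈ labels
  tree_correct : ∀ σ, P.IsSolution (completeTree δ depth) (tree σ)
  leaves_iso : ∀ σ τ, ∃ φ : CompleteNode δ depth ≃ CompleteNode δ depth,
    (completeTree δ depth).IsIso (completeTree δ depth) φ ∧
      ∀ v, (completeTree δ depth).IsLeaf v → tree τ (φ v) = tree σ v
  tree_root : ∀ σ, tree σ (completeTree δ depth).root = σ

/-- A certificate for `O(1)` solvability: a certificate for `O(log* n)` solvability together with an
allowed configuration `(a : b₁, …, a, …, b_δ)` all of whose labels are labels of the certificate,
such that `a` is the label of some leaf of some tree of the certificate. -/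
structure ConstantCertificate {δ : ℕ} {L : Type*} (P : LCLProblem δ L) where
  cert : LogStarCertificate P
  a : L
  b : Fin δ → L
  mem_configs : (a, b) ∈ P.configs
  a_mem : a ∈ cert.labels
  b_mem : ∀ i, b i ∈ cert.labels
  exists_child : ∃ i, b i = a
  exists_leaf : ∃ σ v, (completeTree δ cert.depth).IsLeaf v ∧ cert.tree σ v = a

/-! ### The deterministic CONGEST model on rooted full `δ`-ary trees -/

/-- The communication ports of a node: one towards its parent, and one towards each child. -/
inductive Port (δ : ℕ) : Type
  | up : Port δ
  | down (i : Fin δ) : Port δ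

/-- What a node knows before the first round. -/
structure NodeInput : Type where
  /-- the number of nodes of the tree -/
  size : ℕ
  /-- the maximum degree of the tree -/
  maxDegree : ℕ
  /-- the identifier of the node -/
  ident : ℕ
  /-- the degree of the node -/
  degree : ℕ
  /-- whether the node is the root, that is, whether none of its edges leads to a parent -/
  isRoot : Bool

/-- A deterministic synchronous message passing algorithm; all nodes run the same algorithm.
In every round, each node sends a bit string through each of its ports, receives the bit strings of
its neighbors, and updates its state (local computation is unrestricted). `output s = none` means
that a node in state `s` has not yet decided; decisions are irrevocable. -/
structure DistributedAlgorithm (δ : ℕ) (L : Type*) where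
  State : Type
  start : NodeInput → State
  message : State → Port δ → List Bool
  update : State → (Port δ → Option (List Bool)) → State
  output : State → Option L
  output_stable : ∀ s inbox l, output s = some l → output (update s inbox) = some l

namespace DistributedAlgorithm

variable {δ : ℕ} {L V : Type*}

/-- The initial knowledge of the node `v`. -/
def nodeInput [Fintype V] (G : FullTree δ V) (ident : V → ℕ) (v : V) : NodeInput where
  size := Fintype.card V
  maxDegree := G.maxDegree
  ident := ident v
  degree := G.degree v
  isRoot := (G.up v).isNone

/-- What the node `v` receives through its ports when the nodes are in the states `s`
(`none` at a port that does not exist). -/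
def inbox (A : DistributedAlgorithm δ L) (G : FullTree δ V) (s : V → A.State) (v : V) :
    Port δ → Option (List Bool)
  | Port.up => (G.up v).map fun ui => A.message (s ui.1) (Port.down ui.2)
  | Port.down i => (G.child v i).map fun w => A.message (s w) Port.up

/-- The state of each node after `t` rounds. -/
def run [Fintype V] (A : DistributedAlgorithm δ L) (G : FullTree δ V) (ident : V → ℕ) :
    ℕ → V → A.State
  | 0 => fun v => A.start (nodeInput G ident v)
  | t + 1 => fun v => A.update (run A G ident t v) (A.inbox G (run A G ident t) v)

end DistributedAlgorithm

/-- `P` is solvable in `T n` rounds by a deterministic CONGEST algorithm: for identifiers from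
`{1, …, n ^ c}`, where `c` is any constant, there are an algorithm and a constant `B` such that on
every full `δ`-ary tree with `n` nodes, with arbitrary port numbers and distinct identifiers, every
message has at most `B * (⌊log₂ n⌋ + 1)` bits, and after `T n` rounds all nodes have decided on
outputs that form a solution. -/
def LCLProblem.SolvableInDetCONGEST {δ : ℕ} {L : Type*} (P : LCLProblem δ L) (T : ℕ → ℕ) : Prop :=
  ∀ c : ℕ, ∃ (A : DistributedAlgorithm δ L) (B : ℕ),
    ∀ (V : Type) [Fintype V] (G : FullTree δ V) (ident : V → ℕ),
      Function.Injective ident →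
      (∀ v, 1 ≤ ident v ∧ ident v ≤ Fintype.card V ^ c) →
      (∀ t v p, (A.message (A.run G ident t v) p).length ≤ B * (Nat.log 2 (Fintype.card V) + 1)) ∧
      ∃ lab : V → L,
        (∀ v, A.output (A.run G ident (T (Fintype.card V)) v) = some (lab v)) ∧
        P.IsSolution G lab

/-! It suffices to find a rule `f` that labels a node from boundedly many ports on its way to the
root, continued by a constant letter beyond the root: constantly many rounds of constant-size
messages sent downwards deliver this prefix.

The port words break symmetry. Where a word has no small period, it differs from its translates by
less than `d` steps on a bounded prefix, so a greedy choice by colors (`exists_ruling`) gives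
well-spaced block roots. Where it has one, no such spacing can be computed, but a long repetition
continues downwards through at most one child. The nodes with long repetitions thus form paths, and
the configuration with `a` both at the parent and at a child allows the label `a` along each of
them.

Certificate trees fill the rest. Their leaf labels do not depend on the root label, so a block root
at least `d` below another one knows its label without knowing the one above, and no long chain of
dependencies arises. `exists_decomposition` places a block root exactly `d` steps above each start
of a periodic path; permuting children (`exists_plan`) moves a leaf labeled `a` to that start.
Remaining nodes are labeled greedily, since every certificate label has a continuation. -/

/-! ### Infinite words and functions of bounded prefixes

An infinite word `w : ℕ → α` describes the ports on the way from a node to its ancestors: `w 0` is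
the most recent letter. -/

namespace PortWord

variable {α β γ : Type*}

/-- The word of the child behind port `i`. -/
def push (i : α) (w : ℕ → α) : ℕ → α
  | 0 => i
  | n + 1 => w n

/-- The word of the `j`-th ancestor. -/
def drop (j : ℕ) (w : ℕ → α) : ℕ → α := fun n => w (n + j)

/-- The list of the first `j` letters. -/
def pre : ℕ → (ℕ → α) → List α
  | 0, _ => []
  | j + 1, w => w 0 :: pre j (drop 1 w)

/-- Prepending a finite word. -/
def append (l : List α) (w : ℕ → α) : ℕ → α := l.foldr push w

@[simp] theorem append_cons (i : α) (l : List α) (w : ℕ → α) :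
    append (i :: l) w = push i (append l w) := rfl

@[simp] theorem drop_zero (w : ℕ → α) : drop 0 w = w := rfl

@[simp] theorem drop_succ_push (j : ℕ) (i : α) (w : ℕ → α) : drop (j + 1) (push i w) = drop j w :=
  rfl

theorem drop_drop (i j : ℕ) (w : ℕ → α) : drop i (drop j w) = drop (i + j) w := by
  funext n
  simp [drop, add_assoc]

theorem push_drop (w : ℕ → α) : push (w 0) (drop 1 w) = w := by
  funext n
  cases n <;> rfl

@[simp] theorem length_pre (j : ℕ) (w : ℕ → α) : (pre j w).length = j := by
  induction j generalizing w with
  | zero => rfl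
  | succ j ih => simp [pre, ih]

@[simp] theorem append_pre_drop (j : ℕ) (w : ℕ → α) : append (pre j w) (drop j w) = w := by
  induction j generalizing w with
  | zero => rfl
  | succ j ih =>
    have h := ih (drop 1 w)
    rw [drop_drop] at h
    rw [pre, append_cons, h, push_drop]

@[simp] theorem drop_length_append (l : List α) (w : ℕ → α) : drop l.length (append l w) = w := by
  induction l with
  | nil => rfl
  | cons i l ih => exact ih

@[simp] theorem pre_succ_push (j : ℕ) (i : α) (w : ℕ → α) : pre (j + 1) (push i w) = i :: pre j w :=
  rfl

/-- A function of infinite words is local if it depends only on a prefix of bounded length. -/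
def IsLocal (F : (ℕ → α) → β) : Prop :=
  ∃ K, ∀ w w' : ℕ → α, (∀ n < K, w n = w' n) → F w = F w'

theorem IsLocal.const (b : β) : IsLocal (fun _ : ℕ → α => b) := ⟨0, fun _ _ _ => rfl⟩

theorem IsLocal.map {F : (ℕ → α) → β} (hF : IsLocal F) (g : β → γ) : IsLocal fun w => g (F w) := by
  obtain ⟨K, hK⟩ := hF
  exact ⟨K, fun w w' h => congrArg g (hK w w' h)⟩

theorem IsLocal.prodMk {F : (ℕ → α) → β} {F' : (ℕ → α) → γ} (hF : IsLocal F) (hF' : IsLocal F') :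
    IsLocal fun w => (F w, F' w) := by
  obtain ⟨K, hK⟩ := hF
  obtain ⟨K', hK'⟩ := hF'
  refine ⟨max K K', fun w w' h => ?_⟩
  exact Prod.ext (hK w w' fun n hn => h n (lt_max_of_lt_left hn))
    (hK' w w' fun n hn => h n (lt_max_of_lt_right hn))

theorem IsLocal.map₂ {δ : Type*} {F : (ℕ → α) → β} {F' : (ℕ → α) → γ} (hF : IsLocal F)
    (hF' : IsLocal F') (g : β → γ → δ) : IsLocal fun w => g (F w) (F' w) :=
  (hF.prodMk hF').map fun x => g x.1 x.2

theorem IsLocal.comp_drop {F : (ℕ → α) → β} (hF : IsLocal F) (j : ℕ) :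
    IsLocal fun w => F (drop j w) := by
  obtain ⟨K, hK⟩ := hF
  exact ⟨K + j, fun w w' h => hK _ _ fun n hn => h (n + j) (by omega)⟩

theorem isLocal_apply (j : ℕ) : IsLocal fun w : ℕ → α => w j :=
  ⟨j + 1, fun _ _ h => h j (by omega)⟩

theorem isLocal_pre (j : ℕ) : IsLocal (pre (α := α) j) := by
  induction j with
  | zero => exact IsLocal.const []
  | succ j ih => exact (isLocal_apply 0).map₂ (ih.comp_drop 1) List.cons

theorem exists_uniform_prefix {F : ℕ → (ℕ → α) → β} (hF : ∀ j, IsLocal (F j)) (d : ℕ) :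
    ∃ K, ∀ j < d, ∀ w w' : ℕ → α, (∀ n < K, w n = w' n) → F j w = F j w' := by
  choose K hK using hF
  refine ⟨∑ j ∈ Finset.range d, K j, fun j hj w w' h => hK j w w' fun n hn => h n ?_⟩
  exact hn.trans_le (Finset.single_le_sum (f := K) (fun _ _ => Nat.zero_le _)
    (Finset.mem_range.2 hj))

theorem IsLocal.forall_lt {F : ℕ → (ℕ → α) → Prop} (hF : ∀ j, IsLocal (F j)) (d : ℕ) :
    IsLocal fun w => ∀ j < d, F j w := by
  obtain ⟨K, hK⟩ := exists_uniform_prefix hF d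
  refine ⟨K, fun w w' h => propext ⟨fun H j hj => ?_, fun H j hj => ?_⟩⟩
  · exact (hK j hj w w' h) ▸ H j hj
  · exact (hK j hj w w' h).symm ▸ H j hj

/-- Boundedness of `N` leaves finitely many functions `F j`, which share a prefix length. This gives
locality of data read at the nearest anchor. -/
theorem IsLocal.dep {F : ℕ → (ℕ → α) → β} (hF : ∀ j, IsLocal (F j)) {N : (ℕ → α) → ℕ}
    (hN : IsLocal N) {d : ℕ} (hd : ∀ w, N w < d) : IsLocal fun w => F (N w) w := by
  obtain ⟨K, hK⟩ := exists_uniform_prefix hF d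
  obtain ⟨K', hK'⟩ := hN
  refine ⟨max K K', fun w w' h => ?_⟩
  have h1 : N w = N w' := hK' w w' fun n hn => h n (lt_max_of_lt_right hn)
  change F (N w) w = F (N w') w'
  rw [← h1]
  exact hK _ (hd w) w w' fun n hn => h n (lt_max_of_lt_left hn)

/-! ### Periodic prefixes -/

/-- The first `m` letters of `w` are repeated at distance `p` for some period `1 ≤ p ≤ P`. -/
def Periodic (P m : ℕ) (w : ℕ → α) : Prop := ∃ p, 1 ≤ p ∧ p ≤ P ∧ ∀ k < m, w k = w (k + p)

theorem Periodic.mono {P m m' : ℕ} {w : ℕ → α} (h : Periodic P m' w) (hm : m ≤ m') :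
    Periodic P m w := by
  obtain ⟨p, h1, h2, h3⟩ := h
  exact ⟨p, h1, h2, fun k hk => h3 k (hk.trans_le hm)⟩

theorem Periodic.drop {P m : ℕ} (j : ℕ) {w : ℕ → α} (h : Periodic P (m + j) w) :
    Periodic P m (drop j w) := by
  obtain ⟨p, h1, h2, h3⟩ := h
  refine ⟨p, h1, h2, fun k hk => ?_⟩
  have := h3 (k + j) (by omega)
  simpa [PortWord.drop, add_right_comm] using this

/-- As in the Fine–Wilf theorem, the periods `p` and `q` commute: `w 0 = w p = w (p + q) = w q`.
Hence the period `q` of the tail extends to the first letter. -/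
theorem Periodic.of_drop_one {P m : ℕ} {w : ℕ → α} (hw : Periodic P (P + 1) w) (hm : P ≤ m)
    (h : Periodic P m (PortWord.drop 1 w)) : Periodic P (m + 1) w := by
  obtain ⟨p, p1, p2, hp⟩ := hw
  obtain ⟨q, q1, q2, hq⟩ := h
  refine ⟨q, q1, q2, fun k hk => ?_⟩
  rcases k with _ | k
  · have e1 := hp 0 (by omega)
    have e2 := hp q (by omega)
    have e3 := hq (p - 1) (by omega)
    simp only [PortWord.drop] at e3
    rw [show p - 1 + 1 = p by omega, show p - 1 + q + 1 = q + p by omega] at e3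
    simp only [zero_add] at e1 ⊢
    rw [e1, e3, e2]
  · have := hq k (by omega)
    simpa [PortWord.drop, add_right_comm] using this

/-- Each step towards the root shortens a long repetition by exactly one, even though the period may
change. The length therefore measures the position on a periodic path. -/
theorem periodic_add_iff {P m : ℕ} (j : ℕ) {w : ℕ → α} (hw : Periodic P (P + j) w) (hm : P ≤ m) :
    Periodic P (m + j) w ↔ Periodic P m (drop j w) := by
  refine ⟨Periodic.drop j, ?_⟩
  induction j generalizing w with
  | zero => exact id
  | succ j ih =>
    intro h
    have h1 : Periodic P (m + j) (drop 1 w) := by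
      refine ih (Periodic.drop 1 hw) ?_
      rwa [drop_drop]
    exact Periodic.of_drop_one (m := m + j) (hw.mono (by omega)) (by omega) h1

/-- Following one period and then the other from either first letter ends at the same letter of `w`.
-/
theorem Periodic.letter_unique {P : ℕ} {w : ℕ → α} {i j : α} (hi : Periodic P (P + 1) (push i w))
    (hj : Periodic P (P + 1) (push j w)) : i = j := by
  obtain ⟨p, p1, p2, hp⟩ := hi
  obtain ⟨q, q1, q2, hq⟩ := hj
  obtain ⟨p, rfl⟩ := Nat.exists_eq_add_of_le' p1
  obtain ⟨q, rfl⟩ := Nat.exists_eq_add_of_le' q1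
  have e1 : i = w p := by simpa [push] using hp 0 (by omega)
  have e2 : j = w q := by simpa [push] using hq 0 (by omega)
  have e3 : w q = w (q + 1 + p) := hp (q + 1) (by omega)
  have e4 : w p = w (p + 1 + q) := hq (p + 1) (by omega)
  rw [e1, e2, e3, e4]
  congr 1
  omega

theorem Periodic.append_unique {P m : ℕ} {w : ℕ → α} {u v : List α} (hlen : u.length = v.length)
    (hm : P + u.length ≤ m) (hu : Periodic P m (append u w)) (hv : Periodic P m (append v w)) :
    u = v := by
  induction u generalizing v m with
  | nil => exact (List.length_eq_zero_iff.1 hlen.symm).symm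
  | cons i u ih =>
    rcases v with _ | ⟨j, v⟩
    · simp at hlen
    simp only [List.length_cons, Nat.add_right_cancel_iff] at hlen hm
    obtain ⟨m, rfl⟩ : ∃ m', m = m' + 1 := ⟨m - 1, by omega⟩
    have huv : u = v := ih hlen (by omega) (Periodic.drop 1 hu) (Periodic.drop 1 hv)
    subst huv
    rw [Periodic.letter_unique (hu.mono (by omega)) (hv.mono (by omega))]

theorem isLocal_periodic (P m : ℕ) : IsLocal (Periodic (α := α) P m) := by
  refine ⟨m + P, fun w w' h => propext (exists_congr fun p => and_congr_right fun _ =>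
    and_congr_right fun hp => forall₂_congr fun k hk => ?_)⟩
  rw [h k (by omega), h (k + p) (by omega)]

/-! ### Ruling sets along root-to-leaf paths -/

/-- A set of words none of which has another one among its ancestors at distance less than `d`. -/
def Spaced (d : ℕ) (R : (ℕ → α) → Prop) : Prop := ∀ w, R w → ∀ j < d, 1 ≤ j → ¬R (drop j w)

/-- Colors are processed one at a time. A word sees only its ancestors, so a newcomer yields to
chosen words above it, and a chosen word yields to newcomers above it. Each concession costs less
than `d` steps, hence `2 * d` per color. -/
theorem exists_ruling {d : ℕ} {U : (ℕ → α) → Prop} (hU : IsLocal U) {c : (ℕ → α) → ℕ}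
    (hc : IsLocal c) (hUc : ∀ w, U w → ∀ j < d, 1 ≤ j → U (drop j w) → c w ≠ c (drop j w)) (k : ℕ) :
    ∃ R : (ℕ → α) → Prop, IsLocal R ∧ (∀ w, R w → U w) ∧ Spaced d R ∧
      ∀ w, U w → c w < k → ∃ j ≤ 2 * d * k, R (drop j w) := by
  induction k with
  | zero => exact ⟨fun _ => False, .const _, by simp, by simp [Spaced], by simp⟩
  | succ k ih =>
    obtain ⟨R, hR, hRU, hRs, hRk⟩ := ih
    have free {S : (ℕ → α) → Prop} (hS : IsLocal S) :
        IsLocal fun w => ∀ j < d, 1 ≤ j → ¬S (drop j w) :=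
      IsLocal.forall_lt (fun j => (hS.comp_drop j).map fun p => 1 ≤ j → ¬p) d
    let N : (ℕ → α) → Prop := fun w => (U w ∧ c w = k) ∧ ∀ j < d, 1 ≤ j → ¬R (drop j w)
    have hN : IsLocal N := (hU.map₂ hc fun p n => p ∧ n = k).map₂ (free hR) And
    refine ⟨fun w => N w ∨ R w ∧ ∀ j < d, 1 ≤ j → ¬N (drop j w),
      hN.map₂ (hR.map₂ (free hN) And) Or, ?_, ?_, ?_⟩
    · rintro w (h | h)
      exacts [h.1.1, hRU w h.1]
    · rintro w (h | h) j hj h1 (h' | h')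
      · exact hUc w h.1.1 j hj h1 h'.1.1 (h.1.2.trans h'.1.2.symm)
      · exact h.2 j hj h1 h'.1
      · exact h.2 j hj h1 h'
      · exact hRs w h.1 j hj h1 h'.1
    · have cover : ∀ w, R w → ∃ j ≤ d, N (drop j w) ∨
          R (drop j w) ∧ ∀ i < d, 1 ≤ i → ¬N (drop i (drop j w)) := by
        intro w hw
        by_cases h : ∀ i < d, 1 ≤ i → ¬N (drop i w)
        · exact ⟨0, Nat.zero_le _, Or.inr ⟨hw, h⟩⟩
        · push Not at h
          obtain ⟨i, hi, -, h⟩ := h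
          exact ⟨i, hi.le, Or.inl h⟩
      have cover' : ∀ w i, R (drop i w) → i ≤ 2 * d * k + d → ∃ j ≤ 2 * d * (k + 1), N (drop j w) ∨
          R (drop j w) ∧ ∀ i < d, 1 ≤ i → ¬N (drop i (drop j w)) := by
        intro w i hi hle
        obtain ⟨j, hj, h⟩ := cover _ hi
        rw [drop_drop] at h
        exact ⟨j + i, by rw [mul_add]; omega, h⟩
      intro w hw hwk
      rcases Nat.lt_succ_iff_lt_or_eq.1 hwk with h | h
      · obtain ⟨i, hi, h⟩ := hRk w hw h
        exact cover' w i h (by omega)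
      · by_cases hf : ∀ j < d, 1 ≤ j → ¬R (drop j w)
        · exact ⟨0, Nat.zero_le _, Or.inl ⟨⟨hw, h⟩, hf⟩⟩
        · push Not at hf
          obtain ⟨i, hi, -, hf⟩ := hf
          exact cover' w i hf (by omega)

/-- A decomposition of the infinite `α`-ary tree into periodic paths `D` and blocks with roots `R`:
the block roots are spaced, a block root precedes every start of a path of `D` by exactly `d` steps,
and `R ∪ D` is met within bounded distance. -/
theorem exists_decomposition (α : Type*) [Finite α] {d : ℕ} (hd : 1 ≤ d) :
    ∃ (R D : (ℕ → α) → Prop) (g : ℕ), IsLocal R ∧ IsLocal D ∧ Spaced d R ∧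
      (∀ w, D w → ¬D (drop 1 w) → R (drop d w) ∧ ∀ j ≤ d, 1 ≤ j → ¬D (drop j w)) ∧
      (∀ w (u v : List α), u.length = v.length → u.length ≤ d → D (append u w) → D (append v w) →
        u = v) ∧
      ∀ w, ∃ j ≤ g, R (drop j w) ∨ D (drop j w) := by
  classical
  have := Fintype.ofFinite α
  let n := 3 * d
  -- Repetition length exactly `n`: two such words cannot be less than `d` steps apart on one path,
  -- and `d` steps below there may start a path of words with length `n + d`.
  let E : (ℕ → α) → Prop := fun w => Periodic d n w ∧ ¬Periodic d (n + 1) w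
  -- Since `n - (d - 1) = 2 * d + 1`, the first condition keeps `U` away from proper ancestors of
  -- `E` at distance less than `d`; the second one handles the opposite order.
  let U : (ℕ → α) → Prop := fun w => ¬Periodic d (2 * d + 1) w ∧ ∀ j < d, 1 ≤ j → ¬E (drop j w)
  let c : (ℕ → α) → ℕ := fun w => Fintype.equivFin (Fin (2 * d + 1) → α) fun i => w i
  have hE : IsLocal E := (isLocal_periodic d n).map₂ (isLocal_periodic d (n + 1)) fun p q => p ∧ ¬q
  have hU : IsLocal U := (isLocal_periodic d (2 * d + 1)).map₂
    (IsLocal.forall_lt (fun j => (hE.comp_drop j).map fun p => 1 ≤ j → ¬p) d) fun p q => ¬p ∧ q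
  have hc : IsLocal c := by
    refine ⟨2 * d + 1, fun w w' h => ?_⟩
    have : (fun i : Fin (2 * d + 1) => w i) = fun i : Fin (2 * d + 1) => w' i :=
      funext fun i => h i i.2
    simp only [c, this]
  -- Equal colors at distance `j < d` would make `j` a period of the first `2 * d + 1` letters.
  obtain ⟨R, hR, hRU, hRs, hRg⟩ := exists_ruling (d := d) hU hc (by
    intro w hw j hj h1 _ heq
    refine hw.1 ⟨j, h1, hj.le, fun k hk => ?_⟩
    have := congrFun ((Fintype.equivFin _).injective (Fin.val_injective heq)) ⟨k, hk⟩
    simpa [drop] using this) (Fintype.card (Fin (2 * d + 1) → α))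
  have coverU : ∀ w, ¬Periodic d (2 * d + 1) w →
      ∃ j ≤ d + 2 * d * Fintype.card (Fin (2 * d + 1) → α), E (drop j w) ∨ R (drop j w) := by
    intro w hw
    by_cases h : ∀ j < d, 1 ≤ j → ¬E (drop j w)
    · obtain ⟨j, hj, h⟩ := hRg w ⟨hw, h⟩ (Fin.is_lt _)
      exact ⟨j, by omega, Or.inr h⟩
    · push Not at h
      obtain ⟨j, hj, -, h⟩ := h
      exact ⟨j, by omega, Or.inl h⟩
  have last : ∀ (w : ℕ → α) m k, Periodic d m w → ¬Periodic d (m + k) w →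
      ∃ i < k, Periodic d (m + i) w ∧ ¬Periodic d (m + i + 1) w := by
    intro w m k h0 hk
    induction k with
    | zero => exact absurd h0 hk
    | succ k ih =>
      by_cases h : Periodic d (m + k) w
      · exact ⟨k, Nat.lt_succ_self k, h, hk⟩
      · obtain ⟨i, hi, h⟩ := ih h
        exact ⟨i, by omega, h⟩
  refine ⟨fun w => E w ∨ R w, Periodic d (n + d), 2 * d + 2 * d * Fintype.card (Fin (2 * d + 1) → α),
    hE.map₂ hR Or, isLocal_periodic _ _, ?_, ?_, ?_, ?_⟩
  · rintro w (h | h) j hj h1 (h' | h')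
    · exact h.2 (((periodic_add_iff j (h.1.mono (by omega)) (by omega)).2 h'.1).mono (by omega))
    · refine (hRU _ h').1 (Periodic.drop j (h.1.mono ?_))
      omega
    · exact (hRU _ h).2 j hj h1 h'
    · exact hRs w h j hj h1 h'
  · intro w hw h1
    have h2 : ¬Periodic d (n + d + 1) w := fun h => h1 (Periodic.drop 1 h)
    refine ⟨Or.inl ⟨Periodic.drop d hw, fun h => h2 ?_⟩, fun j hj hj1 h => h2 ?_⟩
    · have := (periodic_add_iff d (hw.mono (by omega)) (by omega)).2 h
      exact this.mono (by omega)
    · exact ((periodic_add_iff j (hw.mono (by omega)) (by omega)).2 h).mono (by omega)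
  · intro w u v h1 h2 hu hv
    exact Periodic.append_unique h1 (by omega) hu hv
  · intro w
    by_cases h1 : Periodic d (n + d) w
    · exact ⟨0, Nat.zero_le _, Or.inr h1⟩
    by_cases h2 : Periodic d n w
    · obtain ⟨i, hi, h3, h4⟩ := last w n d h2 h1
      refine ⟨i, by omega, Or.inl (Or.inl ⟨Periodic.drop i h3, fun h => h4 ?_⟩)⟩
      exact ((periodic_add_iff i (h3.mono (by omega)) (by omega)).2 h).mono (by omega)
    -- For an intermediate repetition length, fewer than `d` steps upwards lead to a word outside
    -- the periodic range, where `coverU` applies.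
    by_cases h3 : Periodic d (2 * d + 1) w
    · obtain ⟨i, hi, h4, h5⟩ := last w (2 * d + 1) (d - 1) h3 (by
        rwa [show 2 * d + 1 + (d - 1) = n by omega])
      obtain ⟨j, hj, h⟩ := coverU (drop (i + 1) w) fun h => h5
        (((periodic_add_iff (i + 1) (h4.mono (by omega)) (by omega)).2 h).mono (by omega))
      rw [drop_drop] at h
      exact ⟨j + (i + 1), by omega, Or.inl h⟩
    · obtain ⟨j, hj, h⟩ := coverU w h3
      exact ⟨j, by omega, Or.inl h⟩

end PortWord

namespace PortWord

variable {α X : Type*}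

/-! ### Labelings from blocks -/

/-- The distance, minus one, to the nearest proper ancestor in `M`. -/
noncomputable def anchorDist (M : (ℕ → α) → Prop) (w : ℕ → α) : ℕ := sInf {j | M (drop (j + 1) w)}

theorem anchorDist_eq {M : (ℕ → α) → Prop} {w : ℕ → α} {j : ℕ} (h : M (drop (j + 1) w))
    (h' : ∀ k < j, ¬M (drop (k + 1) w)) : anchorDist M w = j :=
  le_antisymm (Nat.sInf_le h) (le_csInf ⟨j, h⟩ fun k hk => not_lt.1 fun hlt => h' k hlt hk)

theorem anchorDist_spec {M : (ℕ → α) → Prop} {g : ℕ} (hM : ∀ w, ∃ j ≤ g, M (drop j w))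
    (w : ℕ → α) : anchorDist M w ≤ g ∧ M (drop (anchorDist M w + 1) w) ∧
      ∀ k < anchorDist M w, ¬M (drop (k + 1) w) := by
  obtain ⟨j, hj, h⟩ := hM (drop 1 w)
  rw [drop_drop] at h
  exact ⟨(Nat.sInf_le h).trans hj, Nat.sInf_mem (s := {j | M (drop (j + 1) w)}) ⟨j, h⟩,
    fun k hk h => hk.not_ge (Nat.sInf_le h)⟩

theorem isLocal_anchorDist {M : (ℕ → α) → Prop} {g : ℕ} (hM : ∀ w, ∃ j ≤ g, M (drop j w))
    (hl : IsLocal M) : IsLocal (anchorDist M) := by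
  obtain ⟨K, hK⟩ := exists_uniform_prefix (fun j => hl.comp_drop (j + 1)) (g + 1)
  refine ⟨K, fun w w' h => ?_⟩
  obtain ⟨h1, h2, h3⟩ := anchorDist_spec hM w'
  refine anchorDist_eq ?_ fun k hk => ?_
  · rw [hK _ (by omega) w w' h]
    exact h2
  · rw [hK k (by omega) w w' h]
    exact h3 k hk

theorem anchorDist_push_of_mem {M : (ℕ → α) → Prop} {w : ℕ → α} (h : M w) (i : α) :
    anchorDist M (push i w) = 0 :=
  anchorDist_eq (by simpa using h) (by simp)

theorem anchorDist_push_of_not_mem {M : (ℕ → α) → Prop} {g : ℕ}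
    (hM : ∀ w, ∃ j ≤ g, M (drop j w)) {w : ℕ → α} (h : ¬M w) (i : α) :
    anchorDist M (push i w) = anchorDist M w + 1 := by
  obtain ⟨-, h2, h3⟩ := anchorDist_spec hM w
  refine anchorDist_eq (by simpa using h2) fun k hk => ?_
  rcases k with _ | k
  · simpa using h
  · simpa using h3 k (by omega)

/-- Glueing plans: `pl S σ` labels the words below a node that gets the label `σ`, where `S` is the
set of words that lead to a word of `D`. Below the nodes of `D`, the label `σ` is irrelevant, and it
is irrelevant at depth at least `d` anyway. -/
theorem exists_local_labeling {R D : (ℕ → α) → Prop} {g d : ℕ} (hd : 1 ≤ d) (hR : IsLocal R)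
    (hD : IsLocal D) (hRs : Spaced d R)
    (hent : ∀ w, D w → ¬D (drop 1 w) → R (drop d w) ∧ ∀ j ≤ d, 1 ≤ j → ¬D (drop j w))
    (huniq : ∀ w (u v : List α), u.length = v.length → u.length ≤ d → D (append u w) →
      D (append v w) → u = v)
    (hg : ∀ w, ∃ j ≤ g, R (drop j w) ∨ D (drop j w))
    (ok : X → (α → X) → Prop) (a : X)
    (hplan : ∀ S : Set (List α), (∀ u ∈ S, ∀ v ∈ S, u.length = v.length → u = v) →
      ∃ pl : X → List α → X, (∀ σ l, ok (pl σ l) fun i => pl σ (i :: l)) ∧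
        ([] ∈ S → ∀ σ, pl σ [] = a ∧ (∀ τ, pl σ = pl τ) ∧ ∀ i, [i] ∈ S → pl σ [i] = a) ∧
        ([] ∉ S → ∀ σ, pl σ [] = σ ∧ (∀ τ l, d ≤ l.length → pl σ l = pl τ l) ∧
          ∀ u ∈ S, u.length = d → pl σ u = a)) :
    ∃ f : (ℕ → α) → X, IsLocal f ∧ ∀ w, ok (f w) fun i => f (push i w) := by
  classical
  let A : (ℕ → α) → Set (List α) := fun w => {u | u.length ≤ d ∧ D (append u w)}
  have hA : IsLocal A := by
    obtain ⟨K, hK⟩ := hD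
    have key : ∀ (u : List α) (w w' : ℕ → α), (∀ n < K, w n = w' n) →
        ∀ n < K, append u w n = append u w' n := by
      intro u w w' h
      induction u with
      | nil => exact h
      | cons i u ih =>
        rintro (_ | n) hn
        · rfl
        · exact ih n (by omega)
    exact ⟨K, fun w w' h => Set.ext fun u => and_congr_right fun _ =>
      iff_of_eq (hK _ _ (key u w w' h))⟩
  have hAS : ∀ w, ∀ u ∈ A w, ∀ v ∈ A w, u.length = v.length → u = v :=
    fun w u hu v hv huv => huniq w u v huv hu.1 hu.2 hv.2
  have hA0 : ∀ w, [] ∈ A w ↔ D w := fun w => ⟨fun h => h.2, fun h => ⟨Nat.zero_le _, h⟩⟩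
  have : Nonempty X := ⟨a⟩
  choose! pl hok hplD hplR using hplan
  let M : (ℕ → α) → Prop := fun w => R w ∨ D w
  have hM : IsLocal M := hR.map₂ hD Or
  let e : (ℕ → α) → ℕ → α := fun w => drop (anchorDist M w + 1) w
  let l : (ℕ → α) → List α := fun w => pre (anchorDist M w + 1) w
  have heM : ∀ w, M (e w) := fun w => (anchorDist_spec hg w).2.1
  -- `f₀` pretends that the anchor is labeled `a`. This is harmless at anchors: the anchor above a
  -- word of `R` either lies in `D`, where the plan ignores the label, or is at least `d` steps
  -- away. One level of recursion thus suffices for `f`.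
  let f₀ : (ℕ → α) → X := fun w => if D w then a else pl (A (e w)) a (l w)
  let f : (ℕ → α) → X := fun w => if D w then a else pl (A (e w)) (f₀ (e w)) (l w)
  have hdist := isLocal_anchorDist hg hM
  have hlt : ∀ w, anchorDist M w < g + 1 := fun w => Nat.lt_succ_of_le (anchorDist_spec hg w).1
  have hl : IsLocal l := IsLocal.dep (fun j => isLocal_pre (j + 1)) hdist hlt
  have hAe : IsLocal fun w => A (e w) := IsLocal.dep (fun j => hA.comp_drop (j + 1)) hdist hlt
  have hf₀ : IsLocal f₀ := hD.map₂ (hAe.map₂ hl fun S u => pl S a u) fun p x => if p then a else x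
  have hf₀e : IsLocal fun w => f₀ (e w) := IsLocal.dep (fun j => hf₀.comp_drop (j + 1)) hdist hlt
  have hf : IsLocal f := hD.map₂ ((hAe.prodMk hf₀e).map₂ hl fun S u => pl S.1 S.2 u)
    fun p x => if p then a else x
  have hMf : ∀ w, M w → f w = f₀ w := by
    intro w hw
    by_cases hDw : D w
    · simp only [f, f₀, if_pos hDw]
    simp only [f, f₀, if_neg hDw]
    have hRw : R w := hw.resolve_right hDw
    by_cases hDe : D (e w)
    · rw [(hplD _ (hAS _) ((hA0 _).2 hDe) _).2.1 a]
    · refine (hplR _ (hAS _) (fun h => hDe ((hA0 _).1 h)) _).2.1 a _ ?_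
      by_contra hlt
      simp only [l, length_pre, not_le] at hlt
      exact hRs w hRw _ hlt (by omega) ((heM w).resolve_right hDe)
  -- The plan of the anchor agrees with the label `a` forced on `D`. At the start of a path, the
  -- root `d` steps above must be the anchor `r` itself by spacing, so the start is a leaf of its
  -- block.
  have hleaf : ∀ u r i, M r → (∀ j < u.length, ¬M (drop j (append u r))) →
      D (push i (append u r)) → pl (A r) (f₀ r) (i :: u) = a := by
    intro u r i hr hu hDi
    by_cases hDw : D (append u r)
    · rcases u with _ | ⟨k, u⟩
      · exact ((hplD _ (hAS _) ((hA0 _).2 hDw) _).2.2 i ⟨hd, hDi⟩)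
      · exact absurd (Or.inr hDw) (hu 0 (Nat.succ_pos _))
    obtain ⟨d, rfl⟩ : ∃ d', d = d' + 1 := ⟨d - 1, by omega⟩
    obtain ⟨h1, h2⟩ := hent _ hDi hDw
    rw [drop_succ_push] at h1
    have h3 : u.length ≤ d := not_lt.1 fun h => hu d h (Or.inl h1)
    have hDr : ¬D r := by
      have := h2 (u.length + 1) (by omega) (by omega)
      rwa [drop_succ_push, drop_length_append] at this
    have h4 : u.length = d := by
      refine h3.antisymm (not_lt.1 fun h => hRs r (hr.resolve_right hDr) (d - u.length) (by omega)
        (by omega) ?_)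
      rwa [← drop_length_append u r, drop_drop, Nat.sub_add_cancel h3]
    exact (hplR _ (hAS _) (fun h => hDr ((hA0 _).1 h)) _).2.2 _ ⟨by simp [h4], hDi⟩ (by simp [h4])
  -- the block (or path) which determines the labels of the children of a word
  have hblock : ∀ w, ∃ r u, f w = pl (A r) (f₀ r) u ∧
      ∀ i, f (push i w) = pl (A r) (f₀ r) (i :: u) := by
    intro w
    by_cases hw : M w
    · refine ⟨w, [], ?_, fun i => ?_⟩
      · rw [hMf w hw]
        by_cases hDw : D w
        · rw [(hplD _ (hAS _) ((hA0 _).2 hDw) _).1]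
          exact if_pos hDw
        · rw [(hplR _ (hAS _) (fun h => hDw ((hA0 _).1 h)) _).1]
      · by_cases hDi : D (push i w)
        · rw [hleaf [] w i hw (by simp) hDi]
          exact if_pos hDi
        · simp only [f, if_neg hDi, e, l, anchorDist_push_of_mem hw, zero_add, drop_succ_push,
            drop_zero]
          rfl
    · refine ⟨e w, l w, if_neg fun h => hw (Or.inr h), fun i => ?_⟩
      by_cases hDi : D (push i w)
      · have happ : append (l w) (e w) = w := append_pre_drop _ _
        rw [hleaf (l w) (e w) i (heM w) ?_ (happ.symm ▸ hDi)]
        · exact if_pos hDi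
        · rw [happ]
          rintro (_ | j) hj
          · exact hw
          · refine (anchorDist_spec hg w).2.2 j ?_
            simpa [l] using hj
      · simp only [f, if_neg hDi, e, l, anchorDist_push_of_not_mem hg hw, drop_succ_push,
          pre_succ_push]
  refine ⟨f, hf, fun w => ?_⟩
  obtain ⟨r, u, h1, h2⟩ := hblock w
  rw [h1, funext h2]
  exact hok _ (hAS r) _ _

end PortWord

section

variable {δ : ℕ} {L : Type*}

/-! ### Plans from certificates -/

/-- Permuting the children of the complete tree, by a permutation which depends on the depth. -/
def List.twist {α : Type*} (π : ℕ → Equiv.Perm α) : List α → List α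
  | [] => []
  | i :: l => π l.length i :: twist π l

theorem List.length_twist {α : Type*} (π : ℕ → Equiv.Perm α) (l : List α) :
    (l.twist π).length = l.length := by
  induction l with
  | nil => rfl
  | cons i l ih => simp [List.twist, ih]

theorem List.twist_congr {α : Type*} {π π' : ℕ → Equiv.Perm α} {l : List α}
    (h : ∀ k < l.length, π k = π' k) : l.twist π = l.twist π' := by
  induction l with
  | nil => rfl
  | cons i l ih =>
    rw [List.twist, List.twist, h _ (by simp), ih fun k hk => h k (by simp; omega)]

/-- At each depth, a transposition of the two letters concerned suffices. -/
theorem List.exists_twist_eq {α : Type*} {u v : List α} (h : u.length = v.length) :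
    ∃ π : ℕ → Equiv.Perm α, u.twist π = v := by
  classical
  induction u generalizing v with
  | nil => exact ⟨fun _ => 1, (List.length_eq_zero_iff.1 h.symm).symm⟩
  | cons i u ih =>
    rcases v with _ | ⟨j, v⟩
    · simp at h
    obtain ⟨π, hπ⟩ := ih (Nat.succ_injective h)
    refine ⟨Function.update π u.length (Equiv.swap i j), ?_⟩
    rw [List.twist, Function.update_self, Equiv.swap_apply_left, ← hπ]
    congr 1
    exact List.twist_congr fun k hk => Function.update_of_ne hk.ne _ _

/-- The label `s` may be given to a node whose children have the labels `b i`, in some order. -/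
def LCLProblem.Allows (P : LCLProblem δ L) (s : L) (b : Fin δ → L) : Prop :=
  ∃ ρ : Equiv.Perm (Fin δ), (s, fun i => b (ρ i)) ∈ P.configs

theorem LCLProblem.Allows.perm {P : LCLProblem δ L} {s : L} {b : Fin δ → L} (h : P.Allows s b)
    (π : Equiv.Perm (Fin δ)) : P.Allows s fun i => b (π i) := by
  obtain ⟨ρ, hρ⟩ := h
  exact ⟨ρ.trans π.symm, by simpa using hρ⟩

theorem completeTree_child {d : ℕ} {v : CompleteNode δ d} (h : v.1.length < d) (i : Fin δ) :
    (completeTree δ d).child v i = some ⟨i :: v.1, h⟩ := dif_pos h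

theorem completeTree_parent {d : ℕ} {v w : CompleteNode δ d} :
    (completeTree δ d).parent w = some v ↔ ∃ i, w.1 = i :: v.1 := by
  obtain ⟨_ | ⟨j, w⟩, h⟩ := w
  · simp [FullTree.parent, completeTree]
  · simp [FullTree.parent, completeTree, Subtype.ext_iff, eq_comm]

theorem allows_comp_iso {P : LCLProblem δ L} {d : ℕ} {lab : CompleteNode δ d → L}
    (hlab : P.IsSolution (completeTree δ d) lab) {φ : CompleteNode δ d ≃ CompleteNode δ d}
    (hφ : (completeTree δ d).IsIso (completeTree δ d) φ) (hδ : 1 ≤ δ) {l : List (Fin δ)}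
    (hl : l.length < d) :
    P.Allows (lab (φ ⟨l, hl.le⟩)) fun i => lab (φ ⟨i :: l, hl⟩) := by
  have h : ∀ i, ∃ j, (φ ⟨i :: l, hl⟩).1 = j :: (φ ⟨l, hl.le⟩).1 := by
    intro i
    rw [← completeTree_parent, hφ, completeTree_parent (v := ⟨l, hl.le⟩).2 ⟨i, rfl⟩]
    rfl
  choose j hj using h
  have hj' : Function.Injective j := by
    intro x y hxy
    have := φ.injective (Subtype.ext ((hj x).trans (hxy ▸ (hj y).symm)))
    simpa using this
  -- The image of `l` is not a leaf, as it is the parent of the image of a child of `l`.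
  have hv : (φ ⟨l, hl.le⟩).1.length < d := by
    have := (φ ⟨⟨0, hδ⟩ :: l, hl⟩).2
    rwa [hj] at this
  have hv' : P.Allows (lab (φ ⟨l, hl.le⟩)) fun i => lab ⟨i :: (φ ⟨l, hl.le⟩).1, hv⟩ :=
    hlab (φ ⟨l, hl.le⟩) _ (completeTree_child hv)
  have := hv'.perm (Equiv.ofBijective j (Finite.injective_iff_bijective.1 hj'))
  convert this using 3
  exact Subtype.ext (hj _)

/-- The trees of a certificate, aligned such that they have the same leaves as the tree of `σ₀`. -/
theorem LogStarCertificate.exists_aligned {P : LCLProblem δ L} (S : LogStarCertificate P)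
    (hδ : 1 ≤ δ) (σ₀ : S.labels) :
    ∃ q : S.labels → List (Fin δ) → S.labels, (∀ σ, q σ [] = σ) ∧
      (∀ σ l, l.length < S.depth → P.Allows (q σ l : L) fun i => q σ (i :: l)) ∧
      ∀ σ (v : CompleteNode δ S.depth), v.1.length = S.depth → (q σ v.1 : L) = S.tree σ₀ v := by
  classical
  choose φ hφ hleaf using S.leaves_iso σ₀
  refine ⟨fun σ l => if h : l.length ≤ S.depth then ⟨S.tree σ (φ σ ⟨l, h⟩), S.tree_mem _ _⟩ else σ,
    fun σ => ?_, fun σ l hl => ?_, fun σ v hv => ?_⟩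
  · have : φ σ ⟨[], Nat.zero_le _⟩ = (completeTree δ S.depth).root := by
      rw [← FullTree.up_eq_none_iff, ← Option.map_eq_none_iff (f := Prod.fst)]
      exact hφ σ ⟨[], Nat.zero_le _⟩
    simp only [List.length_nil, Nat.zero_le, dite_true, this, S.tree_root]
  · have h : ∀ i : Fin δ, (i :: l).length ≤ S.depth := fun _ => hl
    simp only [dif_pos hl.le, dif_pos (h _)]
    exact allows_comp_iso (S.tree_correct σ) (hφ σ) hδ hl
  · simp only [dif_pos v.2]
    exact hleaf σ v fun i => dif_neg hv.not_lt

/-- Extending a labeling of the words of length at most `d` greedily. -/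
def greedyExtend {α X : Type*} (d : ℕ) (q : List α → X) (succ : X → α → X) : List α → X
  | [] => q []
  | i :: l => if l.length < d then q (i :: l) else succ (greedyExtend d q succ l) i

theorem greedyExtend_of_le {α X : Type*} {d : ℕ} {q : List α → X} {succ : X → α → X} {l : List α}
    (h : l.length ≤ d) : greedyExtend d q succ l = q l := by
  rcases l with _ | ⟨i, l⟩
  · rfl
  · exact if_pos h

theorem greedyExtend_cons_of_le {α X : Type*} {d : ℕ} {q : List α → X} {succ : X → α → X}
    {l : List α} (h : d ≤ l.length) (i : α) :
    greedyExtend d q succ (i :: l) = succ (greedyExtend d q succ l) i :=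
  if_neg h.not_gt

/-- The greedy part consults only layer `d`, so independence of the root label passes from the
leaves to everything below them. -/
theorem greedyExtend_congr {α X : Type*} {d : ℕ} {q q' : List α → X} {succ : X → α → X}
    (h : ∀ l, l.length = d → q l = q' l) {l : List α} (hl : d ≤ l.length) :
    greedyExtend d q succ l = greedyExtend d q' succ l := by
  induction l with
  | nil =>
    exact h [] (Nat.le_antisymm (Nat.zero_le _) hl)
  | cons i l ih =>
    rcases hl.eq_or_lt with h' | h'
    · rw [greedyExtend_of_le h'.ge, greedyExtend_of_le h'.ge, h _ h'.symm]
    · have := Nat.le_of_lt_succ h'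
      rw [greedyExtend_cons_of_le this, greedyExtend_cons_of_le this, ih this]

theorem ConstantCertificate.exists_plan {P : LCLProblem δ L} (S : ConstantCertificate P)
    (hδ : 1 ≤ δ) (A : Set (List (Fin δ))) (hA : ∀ u ∈ A, ∀ v ∈ A, u.length = v.length → u = v) :
    ∃ pl : S.cert.labels → List (Fin δ) → S.cert.labels,
      (∀ σ l, P.Allows (pl σ l : L) fun i => pl σ (i :: l)) ∧
      ([] ∈ A → ∀ σ, pl σ [] = ⟨S.a, S.a_mem⟩ ∧ (∀ τ, pl σ = pl τ) ∧
        ∀ i, [i] ∈ A → pl σ [i] = ⟨S.a, S.a_mem⟩) ∧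
      ([] ∉ A → ∀ σ, pl σ [] = σ ∧ (∀ τ l, S.cert.depth ≤ l.length → pl σ l = pl τ l) ∧
        ∀ u ∈ A, u.length = S.cert.depth → pl σ u = ⟨S.a, S.a_mem⟩) := by
  classical
  obtain ⟨σ₀, v₀, hv₀, hσ₀⟩ := S.exists_leaf
  have hv₀ : v₀.1.length = S.cert.depth := by
    refine le_antisymm v₀.2 (not_lt.1 fun h => ?_)
    have := hv₀ ⟨0, hδ⟩
    rw [completeTree_child h] at this
    simp at this
  obtain ⟨q, hq0, hq, hqleaf⟩ := S.cert.exists_aligned hδ σ₀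
  -- The top layer of each tree is a continuation of its root label; greedy extension uses it.
  have hsucc : ∀ σ : S.cert.labels, P.Allows (σ : L) fun i => q σ [i] := fun σ => by
    simpa [hq0] using hq σ [] S.cert.one_le_depth
  have hext : ∀ (q' : List (Fin δ) → S.cert.labels) (n : ℕ),
      (∀ l, l.length < n → P.Allows (q' l : L) fun i => q' (i :: l)) →
      ∀ l, P.Allows (greedyExtend n q' (fun σ i => q σ [i]) l).1
        fun i => (greedyExtend n q' (fun σ i => q σ [i]) (i :: l)).1 := by
    intro q' n hq' l
    rcases lt_or_ge l.length n with h | h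
    · have h' : ∀ i : Fin δ, (i :: l).length ≤ n := fun _ => h
      simp only [greedyExtend_of_le h.le, greedyExtend_of_le (h' _)]
      exact hq' l h
    · simp only [greedyExtend_cons_of_le h]
      exact hsucc _
  by_cases hnil : [] ∈ A
  · obtain ⟨k, hk⟩ := S.exists_child
    obtain ⟨i, hi⟩ : ∃ i, ∀ j, [j] ∈ A → j = i := by
      by_cases h : ∃ i, [i] ∈ A
      · obtain ⟨i, hi⟩ := h
        exact ⟨i, fun j hj => by simpa using hA _ hj _ hi rfl⟩
      · exact ⟨⟨0, hδ⟩, fun j hj => absurd ⟨j, hj⟩ h⟩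
    -- The transposition moves the label `b k = a` to the port `i` along which the path continues.
    let q' : List (Fin δ) → S.cert.labels
      | [] => ⟨S.a, S.a_mem⟩
      | j :: _ => ⟨S.b (Equiv.swap i k j), S.b_mem _⟩
    refine ⟨fun _ => greedyExtend 1 q' fun σ i => q σ [i], fun _ => hext q' 1 ?_,
      fun _ _ => ⟨rfl, fun _ => rfl, fun j hj => ?_⟩, fun h => absurd hnil h⟩
    · intro l hl
      obtain rfl : l = [] := List.length_eq_zero_iff.1 (Nat.lt_one_iff.1 hl)
      have : P.Allows S.a S.b := ⟨1, S.mem_configs⟩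
      exact this.perm (Equiv.swap i k)
    · refine (greedyExtend_of_le (d := 1) (l := [j]) le_rfl).trans ?_
      rw [hi j hj]
      exact Subtype.ext (by simp [q', hk])
  -- At most one word of length `depth` must receive `a`. The twist taking it to the leaf `v₀` is
  -- the same for all `σ`, so the leaf labels stay independent of `σ`.
  · obtain ⟨π, hπ⟩ : ∃ π : ℕ → Equiv.Perm (Fin δ),
        ∀ u ∈ A, u.length = S.cert.depth → u.twist π = v₀.1 := by
      by_cases h : ∃ u ∈ A, u.length = S.cert.depth
      · obtain ⟨u, hu, hlen⟩ := h
        obtain ⟨π, hπ⟩ := List.exists_twist_eq (hlen.trans hv₀.symm)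
        exact ⟨π, fun v hv hlen' => hA u hu v hv (hlen.trans hlen'.symm) ▸ hπ⟩
      · exact ⟨fun _ => 1, fun u hu hlen => absurd ⟨u, hu, hlen⟩ h⟩
    refine ⟨fun σ => greedyExtend S.cert.depth (fun l => q σ (l.twist π)) fun σ i => q σ [i],
      fun σ => hext _ _ fun l hl => ?_, fun h => absurd h hnil, fun _ σ => ⟨hq0 σ, ?_, ?_⟩⟩
    · exact (hq σ (l.twist π) (by rwa [List.length_twist])).perm (π l.length)
    · refine fun τ l => greedyExtend_congr fun l hl => Subtype.ext ?_
      have hl' : (l.twist π).length = S.cert.depth := by rw [List.length_twist, hl]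
      exact (hqleaf σ ⟨_, hl'.le⟩ hl').trans (hqleaf τ ⟨_, hl'.le⟩ hl').symm
    · intro u hu hlen
      refine (greedyExtend_of_le hlen.le).trans ?_
      rw [hπ u hu hlen]
      exact Subtype.ext ((hqleaf σ v₀ hv₀).trans hσ₀)

theorem ConstantCertificate.exists_local_labeling {P : LCLProblem δ L} (S : ConstantCertificate P)
    (hδ : 1 ≤ δ) : ∃ f : (ℕ → Fin δ) → L, PortWord.IsLocal f ∧
      ∀ w, P.Allows (f w) fun i => f (PortWord.push i w) := by
  obtain ⟨R, D, g, hR, hD, hRs, hent, huniq, hg⟩ :=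
    PortWord.exists_decomposition (Fin δ) S.cert.one_le_depth
  obtain ⟨f, hf, hok⟩ := PortWord.exists_local_labeling S.cert.one_le_depth hR hD hRs hent
    huniq hg (fun (σ : S.cert.labels) b => P.Allows (σ : L) fun i => b i) _ (S.exists_plan hδ)
  exact ⟨fun w => f w, hf.map _, hok⟩

/-! ### The algorithm -/

/-- The ports on the way from a node to the root, followed by the letter `p` forever. -/
def FullTree.portWord {V : Type*} (G : FullTree δ V) (p : Fin δ) : V → ℕ → Fin δ
  | v, 0 => match G.up v with
    | none => p
    | some (_, i) => i
  | v, n + 1 => match G.up v with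
    | none => p
    | some (u, _) => portWord G p u n

theorem FullTree.portWord_of_up_eq_none {V : Type*} (G : FullTree δ V) (p : Fin δ) {v : V}
    (h : G.up v = none) (n : ℕ) : G.portWord p v n = p := by
  cases n <;> simp [FullTree.portWord, h]

theorem FullTree.portWord_of_up_eq_some {V : Type*} (G : FullTree δ V) (p : Fin δ) {u v : V}
    {i : Fin δ} (h : G.up v = some (u, i)) :
    G.portWord p v = PortWord.push i (G.portWord p u) := by
  funext n
  cases n <;> simp [FullTree.portWord, PortWord.push, h]

/-- A unary code for a word of length `K`. -/
noncomputable def encodePrefix (K : ℕ) (w : ℕ → Fin δ) : List Bool :=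
  List.replicate (Fintype.equivFin (Fin K → Fin δ) fun n => w n) true

/-- The word with a given unary code, followed by the letter `p` forever. -/
noncomputable def decodePrefix (K : ℕ) (p : Fin δ) (m : List Bool) (n : ℕ) : Fin δ :=
  if h : m.length < Fintype.card (Fin K → Fin δ) ∧ n < K then
    (Fintype.equivFin (Fin K → Fin δ)).symm ⟨m.length, h.1⟩ ⟨n, h.2⟩
  else p

theorem decodePrefix_encodePrefix {K : ℕ} (p : Fin δ) (w : ℕ → Fin δ) {n : ℕ} (hn : n < K) :
    decodePrefix K p (encodePrefix K w) n = w n := by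
  have h : (encodePrefix K w).length < Fintype.card (Fin K → Fin δ) ∧ n < K := by
    rw [encodePrefix, List.length_replicate]
    exact ⟨Fin.is_lt _, hn⟩
  rw [decodePrefix, dif_pos h]
  simp [encodePrefix]

/-- The algorithm which, for `K` rounds, sends the first `K` letters of the port words downwards,
and then applies `f`. -/
noncomputable def portWordAlgorithm (K : ℕ) (p : Fin δ) (f : (ℕ → Fin δ) → L) :
    DistributedAlgorithm δ L where
  State := ℕ × (ℕ → Fin δ)
  start := fun _ => (0, fun _ => p)
  message := fun s q => match q with
    | Port.up => []
    | Port.down i => encodePrefix K (PortWord.push i s.2)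
  update := fun s inbox => if K ≤ s.1 then s else
    (s.1 + 1, match inbox Port.up with
      | none => s.2
      | some m => decodePrefix K p m)
  output := fun s => if K ≤ s.1 then some (f s.2) else none
  output_stable := by
    intro s inbox l h
    by_cases hs : K ≤ s.1
    · simpa [hs] using h
    · simp [hs] at h

/-- Each round makes one more letter correct; later letters may still be wrong. The root receives
nothing from above, so its word has to be exact from the start, whence the separate clause. -/
theorem portWordAlgorithm_run {V : Type*} [Fintype V] (K : ℕ) (p : Fin δ) (f : (ℕ → Fin δ) → L)
    (G : FullTree δ V) (ident : V → ℕ) {t : ℕ} (ht : t ≤ K) (v : V) :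
    ((portWordAlgorithm K p f).run G ident t v).1 = t ∧
      (G.up v = none → ((portWordAlgorithm K p f).run G ident t v).2 = fun _ => p) ∧
      ∀ n < t, ((portWordAlgorithm K p f).run G ident t v).2 n = G.portWord p v n := by
  induction t generalizing v with
  | zero => exact ⟨rfl, fun _ => rfl, by simp⟩
  | succ t ih =>
    have ih := fun v => ih (by omega) v
    have hstep : (portWordAlgorithm K p f).run G ident (t + 1) v =
        (t + 1, match (G.up v).map fun ui => encodePrefix K
            (PortWord.push ui.2 ((portWordAlgorithm K p f).run G ident t ui.1).2) with
          | none => ((portWordAlgorithm K p f).run G ident t v).2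
          | some m => decodePrefix K p m) := by
      have h1 : ¬K ≤ ((portWordAlgorithm K p f).run G ident t v).1 := by
        rw [(ih v).1]
        omega
      refine (if_neg h1).trans ?_
      rw [(ih v).1]
      rfl
    rw [hstep]
    rcases hv : G.up v with _ | ⟨u, i⟩
    · simp only [Option.map_none, (ih v).2.1 hv]
      exact ⟨trivial, fun _ => trivial, fun n _ => (G.portWord_of_up_eq_none p hv n).symm⟩
    · refine ⟨rfl, by simp, fun n hn => ?_⟩
      simp only [Option.map_some]
      rw [decodePrefix_encodePrefix _ _ (by omega), G.portWord_of_up_eq_some p hv]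
      rcases n with _ | n
      · rfl
      · exact (ih u).2.2 n (by omega)

theorem solvableInDetCONGEST_of_local_labeling (hδ : 1 ≤ δ) {P : LCLProblem δ L}
    {f : (ℕ → Fin δ) → L} (hf : PortWord.IsLocal f)
    (hok : ∀ w, P.Allows (f w) fun i => f (PortWord.push i w)) :
    ∃ T : ℕ, P.SolvableInDetCONGEST fun _ => T := by
  obtain ⟨K, hK⟩ := hf
  let p : Fin δ := ⟨0, hδ⟩
  refine ⟨K, fun c => ⟨portWordAlgorithm K p f, Fintype.card (Fin K → Fin δ), ?_⟩⟩
  intro V _ G ident _ _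
  refine ⟨fun t v q => ?_, fun v => f (G.portWord p v), fun v => ?_, fun v ch hch => ?_⟩
  -- A unary code is shorter than the number of words of length `K`, whatever the state.
  · refine le_trans ?_ (Nat.le_mul_of_pos_right _ (Nat.succ_pos _))
    rcases q with _ | i
    · exact Nat.zero_le _
    · change (encodePrefix K _).length ≤ _
      rw [encodePrefix, List.length_replicate]
      exact (Fin.is_lt _).le
  · obtain ⟨h1, -, h2⟩ := portWordAlgorithm_run K p f G ident le_rfl v
    exact (if_pos h1.ge).trans (congrArg some (hK _ _ h2))
  · have h : ∀ i, G.portWord p (ch i) = PortWord.push i (G.portWord p v) := fun i =>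
      G.portWord_of_up_eq_some p ((G.child_eq_some_iff _ _ _).1 (hch i))
    simp only [h]
    exact hok _

end

theorem mainTheorem7 {δ : ℕ} (hδ : 1 ≤ δ) {L : Type*} [Finite L] (P : LCLProblem δ L)
    (S : Nonempty (ConstantCertificate P)) :
    ∃ T : ℕ, P.SolvableInDetCONGEST (fun _ => T) := by
  obtain ⟨S⟩ := S
  obtain ⟨f, hf, hok⟩ := S.exists_local_labeling hδ
  exact solvableInDetCONGEST_of_local_labeling hδ hf hok
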